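/- Let $(\Phi_m)_{m\in\omega}$ be the standard enumeration of the partial computable functions, with tuples of arguments coded by a computable pairing function $\langle\cdot,\cdot\rangle$. A CSC (countable second-countable) space on $\omega$ is given by a sequence $\mathcal U=(U_i)_{i\in\omega}$ of subsets of $\omega$ that covers $\omega$, together with a function $k\colon\omega^3\to\omega$ such that $x\in U_{k(i,j,x)}\subseteq U_i\cap U_j$ whenever $x\in U_i\cap U_j$; its topology is the one with base $\mathcal U$. A number $e=\langle m,n\rangle$ is an index of this space if $\Phi_m$ is total with $\Phi_m(i,x)=1$ for $x\in U_i$ and $\Phi_m(i,x)=0$ for $x\notin U_i$, and $\Phi_n$ is total with $\Phi_n(i,j,x)=k(i,j,x)$ for all $i,j,x$. Let $T_3\text{-}CSC$ be the set of indices of CSC spaces whose topology is $T_3$ (regular and Hausdorff; equivalently, by second countability, metrizable), and let $Disc\text{-}CSC$ be the set of indices of CSC spaces whose topology is discrete. Then $Disc\text{-}CSC$ is $\Pi^0_3$-complete within $T_3\text{-}CSC$. That is: 1. there is a $\Pi^0_3$ set $B\subseteq\omega$ with $Disc\text{-}CSC=B\cap T_3\text{-}CSC$; 2. for every $\Pi^0_3$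 set $B\subseteq\omega$ there is a computable function $f\colon\omega\to\omega$ such that for all $e\in\omega$, $f(e)\in T_3\text{-}CSC$, and $e\in B$ if and only if $f(e)\in Disc\text{-}CSC$. -/

import Mathlib

open Nat.Partrec (Code)

/-- A CSC structure on `X` (only countable `X` matter; below `X = ℕ`): a sequence `U` of subsets of `X` that covers `X`,
together with a function `k` that picks, for every point `x` of `U i ∩ U j`, an index of a member
of the sequence that contains `x` and lies inside `U i ∩ U j`. -/
structure CSCBase (X : Type) where
  U : ℕ → Set X
  k : ℕ → ℕ → X → ℕ
  cover : ∀ x, ∃ i, x ∈ U i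
  mem_k : ∀ i j x, x ∈ U i → x ∈ U j → x ∈ U (k i j x)
  k_subset : ∀ i j x, x ∈ U i → x ∈ U j → U (k i j x) ⊆ U i ∩ U j

namespace CSCBase

/-- The topology that has the sets `U i` as a base. -/
abbrev topology {X : Type} (S : CSCBase X) : TopologicalSpace X :=
  TopologicalSpace.generateFrom (Set.range S.U)

/-- The space is `T₃`: regular and `T₀` (hence Hausdorff). -/
def IsT3 {X : Type} (S : CSCBase X) : Prop :=
  @T3Space X S.topology

/-- The space is discrete. -/
def IsDiscrete {X : Type} (S : CSCBase X) : Prop :=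
  @DiscreteTopology X S.topology

end CSCBase

/-- `phi m` is the `m`-th partial computable function `ℕ ⇀ ℕ`. -/
def phi (m : ℕ) : ℕ →. ℕ := (Denumerable.ofNat Code m).eval

open Classical in
/-- `e = ⟨m, n⟩` is an index of the CSC space `S` with underlying set `ℕ`: `phi m` is (total and)
the characteristic function of the sequence `S.U`, and `phi n` is (total and equal to) `S.k`.
Pairs and triples of arguments are coded by the pairing function of `ℕ`. -/
def IsCSCIndex (e : ℕ) (S : CSCBase ℕ) : Prop :=
  (∀ i x : ℕ, phi e.unpair.1 (Nat.pair i x) = Part.some (if x ∈ S.U i then 1 else 0)) ∧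
  (∀ i j x : ℕ, phi e.unpair.2 (Nat.pair i (Nat.pair j x)) = Part.some (S.k i j x))

/-- The indices of `T₃` CSC spaces. -/
def t3CSC : Set ℕ := {e | ∃ S : CSCBase ℕ, IsCSCIndex e S ∧ S.IsT3}

/-- The indices of discrete CSC spaces. -/
def discCSC : Set ℕ := {e | ∃ S : CSCBase ℕ, IsCSCIndex e S ∧ S.IsDiscrete}

/-- The class `Π⁰₃` of sets of natural numbers: `B = {e | ∀ x, ∃ y, ∀ z, R (e, x, y, z)}` for a
computable relation `R`. -/
def PiZeroThree : Set (Set ℕ) :=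
  {B | ∃ R : ℕ × ℕ × ℕ × ℕ → Prop, ComputablePred R ∧
    ∀ e, e ∈ B ↔ ∀ x, ∃ y, ∀ z, R (e, x, y, z)}

/-- `A` is `Γ` within `C`. -/
def IsWithin (Γ : Set (Set ℕ)) (A C : Set ℕ) : Prop :=
  ∃ B ∈ Γ, A = B ∩ C

/-- `A` is `Γ`-hard within `C`. -/
def IsHardWithin (Γ : Set (Set ℕ)) (A C : Set ℕ) : Prop :=
  ∀ B ∈ Γ, ∃ f : ℕ → ℕ, Computable f ∧ ∀ e, f e ∈ C ∧ (e ∈ B ↔ f e ∈ A)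

/-- `A` is `Γ`-complete within `C`. -/
def IsCompleteWithin (Γ : Set (Set ℕ)) (A C : Set ℕ) : Prop :=
  IsWithin Γ A C ∧ IsHardWithin Γ A C

open Topology

namespace CSCBase

variable {X : Type}

/-! A space with a countable base is discrete iff every singleton is a basic set. For an index this
reads: for each `x` there are a basic set and a stage at which it accepts `x`, such that at no stage
does it accept another point. This is a `∀∃∀` condition on a decidable matrix, whence the upper
bound.

For hardness, replace `∃ y, ∀ z` by "finitely often" (`exists_forall_iff_search`): run through the
candidates `y`, dropping one when a counterexample `z` appears; a good `y` exists iff only finitely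
many stages drop a candidate. In `convergentSum`, column `x` has a limit point `⟨x, 0⟩` approached
by the `⟨x, n⟩` at whose stage `n` the search fails. The space is always `T₃`, and is discrete iff
every column has finitely many failures. -/

theorem isTopologicalBasis (S : CSCBase X) :
    @TopologicalSpace.IsTopologicalBasis X S.topology (Set.range S.U) := by
  let := S.topology
  refine ⟨?_, ?_, rfl⟩
  · rintro _ ⟨i, rfl⟩ _ ⟨j, rfl⟩ x ⟨hi, hj⟩
    exact ⟨_, ⟨S.k i j x, rfl⟩, S.mem_k i j x hi hj, S.k_subset i j x hi hj⟩
  · refine Set.eq_univ_of_forall fun x => ?_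
    obtain ⟨i, hi⟩ := S.cover x
    exact ⟨_, ⟨i, rfl⟩, hi⟩

theorem isOpen_U (S : CSCBase X) (i : ℕ) : IsOpen[S.topology] (S.U i) :=
  TopologicalSpace.isOpen_generateFrom_of_mem ⟨i, rfl⟩

/-- An open singleton contains a basic set around its point, and so equals it. -/
theorem isDiscrete_iff (S : CSCBase X) : S.IsDiscrete ↔ ∀ x, ∃ i, S.U i = {x} := by
  let := S.topology
  refine ⟨fun h x => ?_, fun h => ?_⟩
  · have : DiscreteTopology X := h
    obtain ⟨_, ⟨i, rfl⟩, hx, hs⟩ := S.isTopologicalBasis.exists_subset_of_mem_open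
      (Set.mem_singleton x) (isOpen_discrete {x})
    exact ⟨i, hs.antisymm (Set.singleton_subset_iff.2 hx)⟩
  · refine discreteTopology_iff_isOpen_singleton.2 fun x => ?_
    obtain ⟨i, hi⟩ := h x
    exact hi ▸ S.isOpen_U i

theorem IsDiscrete.isT3 {S : CSCBase X} (h : S.IsDiscrete) : S.IsT3 := by
  let := S.topology
  have : DiscreteTopology X := h
  exact (inferInstance : T3Space X)

/-- A base of clopen sets that separates points gives a `T₃` space. -/
theorem isT3_of_isClosed (S : CSCBase X) (hc : ∀ i, ∀ x ∉ S.U i, ∃ j, x ∈ S.U j ∧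
    Disjoint (S.U j) (S.U i)) (hs : ∀ x y, x ≠ y → ∃ i, x ∈ S.U i ∧ y ∉ S.U i ∨
      y ∈ S.U i ∧ x ∉ S.U i) : S.IsT3 := by
  let := S.topology
  have closed : ∀ i, IsClosed (S.U i) := fun i => by
    refine ⟨isOpen_iff_forall_mem_open.2 fun x hx => ?_⟩
    obtain ⟨j, hj, hd⟩ := hc i x hx
    exact ⟨_, Set.subset_compl_iff_disjoint_right.2 hd, S.isOpen_U j, hj⟩
  have : RegularSpace X := .of_exists_mem_nhds_isClosed_subset fun x s hx => by
    obtain ⟨_, ⟨i, rfl⟩, hi, his⟩ := S.isTopologicalBasis.mem_nhds_iff.1 hx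
    exact ⟨_, (S.isOpen_U i).mem_nhds hi, closed i, his⟩
  have : T0Space X := ⟨fun x y hxy => by
    by_contra hne
    obtain ⟨i, h | h⟩ := hs x y hne
    · exact h.2 ((hxy.mem_open_iff (S.isOpen_U i)).1 h.1)
    · exact h.2 ((hxy.mem_open_iff (S.isOpen_U i)).2 h.1)⟩
  exact (inferInstance : T3Space X)

/-- The disjoint sum over `x` of spaces whose points are `⟨x, n⟩`: all `⟨x, n⟩` with `n ≠ 0` are
isolated, and those with `E x n` converge to `⟨x, 0⟩`. The set with index `⟨a, j⟩` is the `j`-th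
basic neighbourhood of `a`. -/
def convergentSum (E : ℕ → ℕ → Prop) : CSCBase ℕ where
  U i := {b | b = i.unpair.1 ∨ (i.unpair.1.unpair.2 = 0 ∧ b.unpair.1 = i.unpair.1.unpair.1 ∧
    b.unpair.2 ≠ 0 ∧ i.unpair.2 ≤ b.unpair.2 ∧ E b.unpair.1 b.unpair.2)}
  k i j b := Nat.pair b (max i.unpair.2 j.unpair.2)
  cover x := ⟨Nat.pair x 0, by simp⟩
  mem_k i j x _ _ := by simp
  k_subset i j x hi hj := by
    rintro b (hb | ⟨h0, h1, h2, h3, h4⟩)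
    · simp only [Nat.unpair_pair] at hb
      subst hb
      exact ⟨hi, hj⟩
    · simp only [Nat.unpair_pair, max_le_iff] at h0 h1 h3
      -- The set chosen by `k` has a point other than `x` only if `x` has second coordinate `0`;
      -- such an `x` lies in a basic set only as its centre.
      have key : ∀ i : ℕ, x = i.unpair.1 ∨ (i.unpair.1.unpair.2 = 0 ∧
          x.unpair.1 = i.unpair.1.unpair.1 ∧ x.unpair.2 ≠ 0 ∧ i.unpair.2 ≤ x.unpair.2 ∧
          E x.unpair.1 x.unpair.2) → x = i.unpair.1 := fun i h =>
        h.resolve_right fun h => h.2.2.1 h0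
      refine ⟨Or.inr ⟨?_, ?_, h2, h3.1, h4⟩, Or.inr ⟨?_, ?_, h2, h3.2, h4⟩⟩
      · rw [← key i hi, h0]
      · rw [← key i hi, h1]
      · rw [← key j hj, h0]
      · rw [← key j hj, h1]

variable (E : ℕ → ℕ → Prop)

theorem mem_convergentSum_U {a j b : ℕ} : b ∈ (convergentSum E).U (Nat.pair a j) ↔
    b = a ∨ (a.unpair.2 = 0 ∧ b.unpair.1 = a.unpair.1 ∧ b.unpair.2 ≠ 0 ∧ j ≤ b.unpair.2 ∧
      E b.unpair.1 b.unpair.2) := by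
  simp [convergentSum]

theorem eq_of_unpair_eq {a b : ℕ} (h₁ : a.unpair.1 = b.unpair.1) (h₂ : a.unpair.2 = b.unpair.2) :
    a = b := by
  rw [← Nat.pair_unpair a, ← Nat.pair_unpair b, h₁, h₂]

theorem convergentSum_isT3 : (convergentSum E).IsT3 := by
  -- The threshold exceeds the second coordinate of the centre of `U i`, so the tail around `x`
  -- misses that centre. Two tails meet only within one column, and then their centres agree.
  refine isT3_of_isClosed _ (fun i x hx => ⟨Nat.pair x (i.unpair.1.unpair.2 + 1), ?_, ?_⟩)
    (fun x y hxy => ?_)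
  · simp [mem_convergentSum_U]
  · obtain ⟨a, j, rfl⟩ : ∃ a j, i = Nat.pair a j := ⟨_, _, (Nat.pair_unpair i).symm⟩
    rw [mem_convergentSum_U, not_or] at hx
    refine Set.disjoint_left.2 fun b hb hb' => ?_
    rw [mem_convergentSum_U] at hb hb'
    rcases hb with rfl | ⟨h0, h1, h2, h3, h4⟩
    · exact hb'.elim hx.1 hx.2
    · rcases hb' with rfl | ⟨h0', h1', -⟩
      · simp at h3
      · exact hx.1 (eq_of_unpair_eq (h1.symm.trans h1') (h0.trans h0'.symm))
  -- A point with second coordinate `0` lies only in the sets centred at it; any other point is the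
  -- sole element of those.
  · by_cases h : y.unpair.2 = 0
    · exact ⟨Nat.pair x 0, .inl ⟨by simp [mem_convergentSum_U], by
        simp [mem_convergentSum_U, h, hxy.symm]⟩⟩
    · exact ⟨Nat.pair y 0, .inr ⟨by simp [mem_convergentSum_U], by
        simp [mem_convergentSum_U, h, hxy]⟩⟩

theorem convergentSum_isDiscrete_iff :
    (convergentSum E).IsDiscrete ↔ ∀ x, ∃ N, ∀ n, N ≤ n → ¬ E x n := by
  rw [isDiscrete_iff]
  constructor
  · intro h x
    obtain ⟨i, hi⟩ := h (Nat.pair x 0)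
    obtain ⟨a, j, rfl⟩ : ∃ a j, i = Nat.pair a j := ⟨_, _, (Nat.pair_unpair i).symm⟩
    have ha : Nat.pair x 0 = a := by
      have : Nat.pair x 0 ∈ (convergentSum E).U (Nat.pair a j) := hi ▸ rfl
      simpa [mem_convergentSum_U] using this
    subst ha
    -- Using `j + 1` instead of `j` ensures `n ≠ 0`.
    refine ⟨j + 1, fun n hn hE => ?_⟩
    have : Nat.pair x n ∈ (convergentSum E).U (Nat.pair (Nat.pair x 0) j) :=
      (mem_convergentSum_U E).2 (.inr (by simpa using ⟨by omega, by omega, hE⟩))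
    rw [hi, Set.mem_singleton_iff, Nat.pair_eq_pair] at this
    omega
  · intro h x
    obtain ⟨N, hN⟩ := h x.unpair.1
    refine ⟨Nat.pair x N, Set.ext fun b => ?_⟩
    rw [mem_convergentSum_U, Set.mem_singleton_iff, or_iff_left]
    rintro ⟨-, h1, -, h3, h4⟩
    exact hN _ h3 (h1 ▸ h4)

end CSCBase

/-! ### Upper bound: discreteness of an indexed space is `Π⁰₃`. -/

theorem IsCSCIndex.mem_U_iff {e : ℕ} {S : CSCBase ℕ} (h : IsCSCIndex e S) (i x : ℕ) :
    x ∈ S.U i ↔ 1 ∈ phi e.unpair.1 (Nat.pair i x) := by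
  rw [h.1]
  by_cases hx : x ∈ S.U i <;> simp [hx]

/-- An index determines `U`, on which alone discreteness depends, so `discCSC` can be tested on any
one space with that index. -/
theorem IsCSCIndex.isDiscrete_congr {e : ℕ} {S T : CSCBase ℕ} (hS : IsCSCIndex e S)
    (hT : IsCSCIndex e T) : S.IsDiscrete ↔ T.IsDiscrete := by
  have : S.U = T.U := funext fun i => Set.ext fun x => by rw [hS.mem_U_iff, hT.mem_U_iff]
  rw [CSCBase.isDiscrete_iff, CSCBase.isDiscrete_iff, this]

theorem IsCSCIndex.mem_discCSC_iff {e : ℕ} {S : CSCBase ℕ} (h : IsCSCIndex e S) :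
    e ∈ discCSC ↔ S.IsDiscrete :=
  ⟨fun ⟨_, hT, hd⟩ => (hT.isDiscrete_congr h).1 hd, fun hd => ⟨S, h, hd⟩⟩

theorem discCSC_subset_t3CSC : discCSC ⊆ t3CSC :=
  fun _ ⟨S, h, hd⟩ => ⟨S, h, hd.isT3⟩

/-- `phi m` applied to `⟨i, x⟩` outputs `1` within `s` steps. -/
def AcceptsWithin (s m i x : ℕ) : Prop :=
  Code.evaln s (Denumerable.ofNat Code m) (Nat.pair i x) = some 1

theorem one_mem_phi_iff {m i x : ℕ} :
    1 ∈ phi m (Nat.pair i x) ↔ ∃ s, AcceptsWithin s m i x :=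
  Code.evaln_complete

theorem PrimrecPred.acceptsWithin {α : Type*} [Primcodable α] {s m i x : α → ℕ} (hs : Primrec s)
    (hm : Primrec m) (hi : Primrec i) (hx : Primrec x) :
    PrimrecPred fun a => AcceptsWithin (s a) (m a) (i a) (x a) :=
  Primrec.eq.comp (Code.primrec_evaln.comp ((hs.pair ((Primrec.ofNat Code).comp hm)).pair
    (Primrec₂.natPair.comp hi hx))) (Primrec.const (some 1))

/-- The condition that every point `x` has an `i` for which `phi e.unpair.1` accepts `⟨i, x⟩` and
no other `⟨i, y⟩`. -/
def singletonBaseIndices : Set ℕ :=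
  {e | ∀ x, ∃ y, ∀ z, AcceptsWithin (Nat.unpair y).2 (Nat.unpair e).1 (Nat.unpair y).1 x ∧
    ((Nat.unpair z).1 = x ∨
      ¬ AcceptsWithin (Nat.unpair z).2 (Nat.unpair e).1 (Nat.unpair y).1 (Nat.unpair z).1)}

/-- Here `y` codes a basic index with a stage, and `z` a point with a stage; bounding the stages
makes the matrix primitive recursive. -/
theorem singletonBaseIndices_mem : singletonBaseIndices ∈ PiZeroThree := by
  refine ⟨fun p => AcceptsWithin (Nat.unpair p.2.2.1).2 (Nat.unpair p.1).1
    (Nat.unpair p.2.2.1).1 p.2.1 ∧ ((Nat.unpair p.2.2.2).1 = p.2.1 ∨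
      ¬ AcceptsWithin (Nat.unpair p.2.2.2).2 (Nat.unpair p.1).1 (Nat.unpair p.2.2.1).1
        (Nat.unpair p.2.2.2).1), ?_, fun e => Iff.rfl⟩
  have hx : Primrec fun p : ℕ × ℕ × ℕ × ℕ => p.2.1 := Primrec.fst.comp Primrec.snd
  have hy : Primrec fun p : ℕ × ℕ × ℕ × ℕ => p.2.2.1 :=
    Primrec.fst.comp (Primrec.snd.comp Primrec.snd)
  have hz : Primrec fun p : ℕ × ℕ × ℕ × ℕ => p.2.2.2 :=
    Primrec.snd.comp (Primrec.snd.comp Primrec.snd)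
  have hm : Primrec fun p : ℕ × ℕ × ℕ × ℕ => (Nat.unpair p.1).1 :=
    Primrec.fst.comp (Primrec.unpair.comp Primrec.fst)
  have hy₁ := Primrec.fst.comp (Primrec.unpair.comp hy)
  have hy₂ := Primrec.snd.comp (Primrec.unpair.comp hy)
  have hz₁ := Primrec.fst.comp (Primrec.unpair.comp hz)
  have hz₂ := Primrec.snd.comp (Primrec.unpair.comp hz)
  obtain ⟨d, h⟩ := (PrimrecPred.acceptsWithin hy₂ hm hy₁ hx).and
    ((Primrec.eq.comp hz₁ hx).or (PrimrecPred.acceptsWithin hz₂ hm hy₁ hz₁).not)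
  exact ⟨d, h.to_comp⟩

theorem IsCSCIndex.isDiscrete_iff_mem {e : ℕ} {S : CSCBase ℕ} (h : IsCSCIndex e S) :
    S.IsDiscrete ↔ e ∈ singletonBaseIndices := by
  rw [CSCBase.isDiscrete_iff]
  refine forall_congr' fun x => ⟨?_, ?_⟩
  · rintro ⟨i, hi⟩
    obtain ⟨s, hs⟩ := one_mem_phi_iff.1 ((h.mem_U_iff i x).1 (hi ▸ rfl))
    refine ⟨Nat.pair i s, fun z => ⟨by simpa using hs, or_iff_not_imp_right.2 fun hz => ?_⟩⟩
    rw [not_not, Nat.unpair_pair] at hz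
    have := (h.mem_U_iff i _).2 (one_mem_phi_iff.2 ⟨_, hz⟩)
    rwa [hi] at this
  · rintro ⟨y, hy⟩
    refine ⟨y.unpair.1, Set.ext fun z => ⟨fun hz => ?_, ?_⟩⟩
    · obtain ⟨t, ht⟩ := one_mem_phi_iff.1 ((h.mem_U_iff _ z).1 hz)
      have := (hy (Nat.pair z t)).2
      simp only [Nat.unpair_pair] at this
      exact this.resolve_right (not_not.2 ht)
    · rintro rfl
      -- The first conjunct does not involve `z`, so any value serves.
      exact (h.mem_U_iff _ _).2 (one_mem_phi_iff.2 ⟨_, (hy 0).1⟩)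

theorem discCSC_isWithin : IsWithin PiZeroThree discCSC t3CSC := by
  refine ⟨_, singletonBaseIndices_mem, Set.ext fun e => ⟨fun he => ?_, ?_⟩⟩
  · refine ⟨?_, discCSC_subset_t3CSC he⟩
    obtain ⟨S, h, hd⟩ := he
    exact h.isDiscrete_iff_mem.1 hd
  · rintro ⟨he, S, h, -⟩
    exact ⟨S, h, h.isDiscrete_iff_mem.2 he⟩

/-- The search for a `y` with `∀ z, Q y z`: the state `(y, z)` advances to `(y, z + 1)` if `Q y z`
holds, and to `(y + 1, 0)` otherwise. -/
def searchState (Q : ℕ → ℕ → Bool) (s : ℕ) : ℕ × ℕ :=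
  Nat.rec (0, 0) (fun _ p => bif Q p.1 p.2 then (p.1, p.2 + 1) else (p.1 + 1, 0)) s

/-! ### Hardness: from `∃ y, ∀ z` to finitely many failures. -/

section Search

variable {Q : ℕ → ℕ → Bool}

/-- The search gives up its candidate `y` at stage `s`. -/
def SearchFailsAt (Q : ℕ → ℕ → Bool) (s : ℕ) : Prop :=
  Q (searchState Q s).1 (searchState Q s).2 = false

theorem searchState_succ_of_failsAt {s : ℕ} (h : SearchFailsAt Q s) :
    searchState Q (s + 1) = ((searchState Q s).1 + 1, 0) := by
  change (bif Q (searchState Q s).1 (searchState Q s).2 then _ else _) = _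
  rw [show Q (searchState Q s).1 (searchState Q s).2 = false from h]
  rfl

theorem searchState_succ_of_not_failsAt {s : ℕ} (h : ¬ SearchFailsAt Q s) :
    searchState Q (s + 1) = ((searchState Q s).1, (searchState Q s).2 + 1) := by
  change (bif Q (searchState Q s).1 (searchState Q s).2 then _ else _) = _
  rw [show Q (searchState Q s).1 (searchState Q s).2 = true from Bool.not_eq_false _ ▸ h]
  rfl

theorem searchState_checked (s : ℕ) :
    ∀ z < (searchState Q s).2, Q (searchState Q s).1 z = true := by
  induction s with
  | zero => exact fun z hz => absurd hz (Nat.not_lt_zero z)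
  | succ s ih =>
    by_cases h : SearchFailsAt Q s
    · simp [searchState_succ_of_failsAt h]
    · rw [searchState_succ_of_not_failsAt h]
      intro z hz
      rcases Nat.lt_succ_iff_lt_or_eq.1 hz with hz | rfl
      · exact ih z hz
      · simpa [SearchFailsAt] using h

theorem searchState_fst_le {y : ℕ} (hy : ∀ z, Q y z = true) (s : ℕ) :
    (searchState Q s).1 ≤ y := by
  induction s with
  | zero => exact Nat.zero_le y
  | succ s ih =>
    by_cases h : SearchFailsAt Q s
    · rw [searchState_succ_of_failsAt h]
      refine Nat.succ_le_of_lt (lt_of_le_of_ne ih fun he => ?_)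
      rw [SearchFailsAt, he, hy] at h
      cases h
    · rwa [searchState_succ_of_not_failsAt h]

theorem monotone_searchState_fst : Monotone fun s => (searchState Q s).1 :=
  monotone_nat_of_le_succ fun s => by
    by_cases h : SearchFailsAt Q s
    · simp [searchState_succ_of_failsAt h]
    · simp [searchState_succ_of_not_failsAt h]

theorem searchState_add {N : ℕ} (hN : ∀ n, N ≤ n → ¬ SearchFailsAt Q n) (t : ℕ) :
    searchState Q (N + t) = ((searchState Q N).1, (searchState Q N).2 + t) := by
  induction t with
  | zero => rfl
  | succ t ih =>
    rw [← Nat.add_assoc, searchState_succ_of_not_failsAt (hN _ (Nat.le_add_right N t)), ih]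
    rfl

/-- Each failure raises the candidate, which can never pass a good `y`. Conversely, after the last
failure the candidate is fixed and every `z` gets checked against it. -/
theorem exists_forall_iff_search : (∃ y, ∀ z, Q y z = true) ↔
    ∃ N, ∀ n, N ≤ n → ¬ SearchFailsAt Q n := by
  constructor
  · rintro ⟨y, hy⟩
    by_contra! hN
    have : ∀ k, ∃ s, k ≤ (searchState Q s).1 := fun k => by
      induction k with
      | zero => exact ⟨0, Nat.zero_le _⟩
      | succ k ih =>
        obtain ⟨s, hs⟩ := ih
        obtain ⟨n, hn, hf⟩ := hN s
        refine ⟨n + 1, ?_⟩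
        rw [searchState_succ_of_failsAt hf]
        exact Nat.succ_le_succ (hs.trans (monotone_searchState_fst hn))
    obtain ⟨s, hs⟩ := this (y + 1)
    exact absurd (searchState_fst_le hy s) (by omega)
  · rintro ⟨N, hN⟩
    refine ⟨(searchState Q N).1, fun z => ?_⟩
    have := searchState_checked (Q := Q) (N + (z + 1)) z
    rw [searchState_add hN] at this
    exact this (by dsimp only; omega)

end Search

theorem Computable.searchState {α : Type*} [Primcodable α] {Q : α → ℕ → ℕ → Bool} {n : α → ℕ}
    (hQ : Computable fun p : α × ℕ × ℕ => Q p.1 p.2.1 p.2.2) (hn : Computable n) :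
    Computable fun a => searchState (Q a) (n a) := by
  have hy : Computable fun p : α × ℕ × ℕ × ℕ => p.2.2.1 :=
    fst.comp (snd.comp snd)
  have hz : Computable fun p : α × ℕ × ℕ × ℕ => p.2.2.2 :=
    snd.comp (snd.comp snd)
  refine Computable.nat_rec (h := fun a p =>
    bif Q a p.2.1 p.2.2 then (p.2.1, p.2.2 + 1) else (p.2.1 + 1, 0)) hn (const (0, 0)) ?_
  exact Computable.cond (hQ.comp (fst.pair (snd.comp snd)))
    (hy.pair (succ.comp hz)) ((succ.comp hy).pair (const 0))

theorem exists_code_of_computable {g : ℕ → ℕ} (hg : Computable g) :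
    ∃ c : Code, ∀ n, c.eval n = Part.some (g n) := by
  obtain ⟨c, hc⟩ := Code.exists_code.1 (Partrec.nat_iff.1 hg)
  exact ⟨c, fun n => by rw [hc]; rfl⟩

/-- A uniformly decidable family of CSC bases with a common computable `k` has uniformly computable
indices. -/
theorem exists_computable_isCSCIndex {S : ℕ → CSCBase ℕ} {k : ℕ → ℕ → ℕ → ℕ}
    (hU : ComputablePred fun p : ℕ × ℕ × ℕ => p.2.2 ∈ (S p.1).U p.2.1)
    (hk : Computable fun p : ℕ × ℕ × ℕ => k p.1 p.2.1 p.2.2) (hS : ∀ e, (S e).k = k) :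
    ∃ f : ℕ → ℕ, Computable f ∧ ∀ e, IsCSCIndex (f e) (S e) := by
  obtain ⟨u, hu, hUu⟩ := ComputablePred.computable_iff.1 hU
  have h₁ : Computable fun n : ℕ => n.unpair.1 := Computable.fst.comp Primrec.unpair.to_comp
  have h₂ : Computable fun n : ℕ => n.unpair.2 := Computable.snd.comp Primrec.unpair.to_comp
  have triple := h₁.pair ((h₁.comp h₂).pair (h₂.comp h₂))
  obtain ⟨c, hc⟩ := exists_code_of_computable
    (Computable.cond (hu.comp triple) (Computable.const 1) (Computable.const 0))
  obtain ⟨d, hd⟩ := exists_code_of_computable (hk.comp triple)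
  -- The s-m-n theorem builds `e` into the program for `U`; the program for `k` is the same for all
  -- `e`.
  refine ⟨fun e => Nat.pair (Encodable.encode (Code.curry c e)) (Encodable.encode d),
    Primrec₂.natPair.to_comp.comp (Computable.encode.comp
      (Code.primrec₂_curry.to_comp.comp (Computable.const c) Computable.id))
      (Computable.const _), fun e => ⟨fun i x => ?_, fun i j x => ?_⟩⟩
  · have : x ∈ (S e).U i ↔ u (e, i, x) = true := by rw [← congrFun hUu (e, i, x)]
    simp only [phi, Nat.unpair_pair, Denumerable.ofNat_encode, Code.eval_curry, hc, this]
    cases u (e, i, x) <;> simp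
  · simp [phi, hd, hS]

theorem computablePred_mem_convergentSum {E : ℕ → ℕ → ℕ → Prop}
    (hE : ComputablePred fun p : ℕ × ℕ × ℕ => E p.1 p.2.1 p.2.2) :
    ComputablePred fun p : ℕ × ℕ × ℕ => p.2.2 ∈ (CSCBase.convergentSum (E p.1)).U p.2.1 := by
  obtain ⟨u, hu, hEu⟩ := ComputablePred.computable_iff.1 hE
  have h₁ : Primrec fun n : ℕ => n.unpair.1 := Primrec.fst.comp Primrec.unpair
  have h₂ : Primrec fun n : ℕ => n.unpair.2 := Primrec.snd.comp Primrec.unpair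
  have hi : Primrec fun p : ℕ × ℕ × ℕ => p.2.1 := Primrec.fst.comp Primrec.snd
  have hb : Primrec fun p : ℕ × ℕ × ℕ => p.2.2 := Primrec.snd.comp Primrec.snd
  obtain ⟨_, heq⟩ := Primrec.eq.comp hb (h₁.comp hi)
  obtain ⟨_, hnear⟩ := (Primrec.eq.comp (h₂.comp (h₁.comp hi)) (Primrec.const 0)).and
    ((Primrec.eq.comp (h₁.comp hb) (h₁.comp (h₁.comp hi))).and
      ((Primrec.eq.comp (h₂.comp hb) (Primrec.const 0)).not.and
        (Primrec.nat_le.comp (h₂.comp hi) (h₂.comp hb))))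
  have hE' := hu.comp (Computable.fst.pair ((h₁.comp hb).to_comp.pair (h₂.comp hb).to_comp))
  refine ComputablePred.computable_iff.2 ⟨_, Primrec.or.to_comp.comp heq.to_comp
    (Primrec.and.to_comp.comp hnear.to_comp hE'), funext fun p => propext ?_⟩
  have := congrFun hEu (p.1, p.2.2.unpair.1, p.2.2.unpair.2)
  simp only [eq_iff_iff] at this
  simp [CSCBase.convergentSum, this, and_assoc]

theorem discCSC_isHardWithin : IsHardWithin PiZeroThree discCSC t3CSC := by
  rintro B ⟨R, hR, hB⟩
  obtain ⟨r, hr, rfl⟩ := ComputablePred.computable_iff.1 hR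
  -- Column `x` of the `e`-th space records the failing stages of the search for a `y` that is good
  -- for `(e, x)`.
  let E : ℕ → ℕ → ℕ → Prop := fun e x => SearchFailsAt fun y z => r (e, x, y, z)
  have hE : ComputablePred fun p : ℕ × ℕ × ℕ => E p.1 p.2.1 p.2.2 := by
    have hs := Computable.searchState (Q := fun (p : ℕ × ℕ × ℕ) y z => r (p.1, p.2.1, y, z))
      (hr.comp ((Computable.fst.comp .fst).pair
        ((Computable.fst.comp (Computable.snd.comp .fst)).pair .snd)))
      (Computable.snd.comp Computable.snd)
    have := hr.comp (Computable.fst.pair ((Computable.fst.comp Computable.snd).pair hs))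
    exact (Computable.computablePred (p := fun p : ℕ × ℕ × ℕ => _ = true)
      (by simpa using this)).not.of_eq fun p => by simp [E, SearchFailsAt]
  obtain ⟨f, hf, hfS⟩ := exists_computable_isCSCIndex
    (S := fun e => CSCBase.convergentSum (E e))
    (k := fun i j b => Nat.pair b (max i.unpair.2 j.unpair.2))
    (computablePred_mem_convergentSum hE) (by
      have h₂ : Computable fun n : ℕ => n.unpair.2 :=
        Computable.snd.comp Primrec.unpair.to_comp
      exact Primrec₂.natPair.to_comp.comp (Computable.snd.comp Computable.snd)
        (Primrec.nat_max.to_comp.comp (h₂.comp Computable.fst)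
          (h₂.comp (Computable.fst.comp Computable.snd)))) fun e => rfl
  refine ⟨f, hf, fun e => ⟨⟨_, hfS e, CSCBase.convergentSum_isT3 _⟩, ?_⟩⟩
  rw [(hfS e).mem_discCSC_iff, CSCBase.convergentSum_isDiscrete_iff, hB]
  exact forall_congr' fun x => exists_forall_iff_search

theorem mainTheorem12 : IsCompleteWithin PiZeroThree discCSC t3CSC :=
  ⟨discCSC_isWithin, discCSC_isHardWithin⟩
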